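/- All graphs are finite, simple and undirected. For $k\ge 1$, a graph $G$ with a vertex colouring and a tuple $\vec x$ of its vertices, let $\mathrm{atp}(G,\vec x)$ be the atomic type of $\vec x$, so that $\mathrm{atp}(G,\vec x)=\mathrm{atp}(H,\vec y)$ if and only if $x_i\mapsto y_i$ is a (colour-preserving) partial isomorphism. The $k$-dimensional Weisfeiler--Leman algorithm ($k$-WL) assigns to $\vec v\in V(G)^k$ the colours $\mathrm{WL}_k^0(G,\vec v)=\mathrm{atp}(G,\vec v)$ and \[ \mathrm{WL}_k^{d+1}(G,\vec v)=\Bigl(\mathrm{WL}_k^{d}(G,\vec v),\ \bigl\{\!\!\bigl\{\bigl(\mathrm{atp}(G,\vec v w),\mathrm{WL}_k^{d}(G,\vec v[1/w]),\dots,\mathrm{WL}_k^{d}(G,\vec v[k/w])\bigr)\ \big|\ w\in V(G)\bigr\}\!\!\bigr\}\Bigr), \] where $\vec v[i/w]$ is $\vec v$ with its $i$-th entry replaced by $w$. Two graphs are $k$-WL indistinguishable if the multisets of the colours of all their $k$-tuples of vertices coincide for every $d\ge 0$ (equivalently, if the multisets of their stable colours coincide); uncoloured graphs are treated as graphs all of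 whose vertices have the same colour. Two graphs $G$ and $H$ are $(1,1)$-WL indistinguishable if there is a bijection $\pi\colon V(G)\to V(H)$ such that for all $v\in V(G)$ the vertex-individualised graphs $G_v$ and $H_{\pi(v)}$ are $1$-WL indistinguishable, where $G_v$ is obtained from $G$ by colouring $v$ orange and all other vertices grey. Let $\lambda_1<\dots<\lambda_m$ be the distinct eigenvalues of the adjacency matrix $A(G)$ and let $P^{(1)},\dots,P^{(m)}$ be the (orthogonal) projections onto the respective eigenspaces. Fürer's spectral invariant of $G$ is \[ \mathcal F(G)=\bigl(\operatorname{Spec}A(G),\ \{\!\!\{P_v\mid v\in V(G)\}\!\!\}\bigr),\qquad P_v=\bigl(p_{vv},\{\!\!\{p_{vw}\mid w\in V(G)\}\!\!\}\bigr),\qquad p_{vw}=\bigl(P^{(1)}_{vw},\dots,P^{(m)}_{vw}\bigr), \] where $\operatorname{Spec}A(G)$ is the multiset of the eigenvalues of $A(G)$ with geometric multiplicities. **Theorem.** If $G$ and $H$ are $(1,1)$-WL indistinguishable, then $\mathcal F(G)=\mathcal F(H)$. Fürer's spectral invariant is strictly weaker than $2$-WL: if $G$ and $H$ are $2$-WL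 indistinguishable, then $\mathcal F(G)=\mathcal F(H)$, and there are graphs $G$ and $H$ with $\mathcal F(G)=\mathcal F(H)$ that are not $2$-WL indistinguishable. -/

import Mathlib

/-! ## The Weisfeiler–Leman algorithm on finite simple graphs with coloured vertices -/

/-- Isomorphism types of vertex-coloured graphs with an ordered `ℓ`-tuple of vertices: which
entries of the tuple are equal, which are adjacent, and which colours they have. -/
@[ext]
structure AtomicType (C : Type) (ℓ : ℕ) : Type where
  eq : Fin ℓ → Fin ℓ → Prop
  adj : Fin ℓ → Fin ℓ → Prop
  colour : Fin ℓ → C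

/-- The atomic type of a tuple `x` in the graph `G` with vertex colouring `c`.  Two tuples `x` and
`y` have the same atomic type if and only if `x i ↦ y i` is a partial isomorphism. -/
def atp {V : Type*} {C : Type} (G : SimpleGraph V) (c : V → C) {ℓ : ℕ} (x : Fin ℓ → V) :
    AtomicType C ℓ where
  eq i j := x i = x j
  adj i j := G.Adj (x i) (x j)
  colour i := c (x i)

/-- The colours that `k`-WL may assign in iteration `d`. They do not depend on the graph, so that
colours computed in different graphs can be compared. -/
def WLColour (C : Type) (k : ℕ) : ℕ → Type
  | 0 => AtomicType C k
  | d + 1 => WLColour C k d × Multiset (AtomicType C (k + 1) × (Fin k → WLColour C k d))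

/-- The colour of the `k`-tuple `x` after `d` iterations of `k`-WL on the graph `G` with vertex
colouring `c`.  The tuple `Fin.snoc x w` is `x` extended by `w`, and `Function.update x i w` is `x`
with its `i`-th entry replaced by `w`. -/
def wl {V : Type*} [Fintype V] {C : Type} (G : SimpleGraph V) (c : V → C) (k : ℕ) :
    (d : ℕ) → (Fin k → V) → WLColour C k d
  | 0, x => atp G c x
  | d + 1, x =>
    (wl G c k d x,
      (Finset.univ : Finset V).val.map fun w =>
        (atp G c (Fin.snoc x w : Fin (k + 1) → V), fun i => wl G c k d (Function.update x i w)))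

/-- The multiset of the colours of all `k`-tuples after `d` iterations of `k`-WL. -/
def wlMultiset {V : Type*} [Fintype V] {C : Type} (G : SimpleGraph V) (c : V → C)
    (k d : ℕ) : Multiset (WLColour C k d) :=
  (Finset.univ : Finset (Fin k → V)).val.map (wl G c k d)

/-- Two coloured graphs are `k`-WL indistinguishable: the multisets of colours of `k`-tuples
coincide in every iteration.  By `colouredWLIndist_iff_stable` below, it is the same to ask that
the multisets of stable colours coincide. -/
def ColouredWLIndist {V W : Type*} [Fintype V] [Fintype W] {C : Type} (k : ℕ)
    (G : SimpleGraph V) (c : V → C) (H : SimpleGraph W) (c' : W → C) : Prop :=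
  ∀ d : ℕ, wlMultiset G c k d = wlMultiset H c' k d

/-- Two (uncoloured) graphs are `k`-WL indistinguishable: all vertices get the same colour. -/
def WLIndist {V W : Type*} [Fintype V] [Fintype W] (k : ℕ)
    (G : SimpleGraph V) (H : SimpleGraph W) : Prop :=
  ColouredWLIndist k G (fun _ => ()) H (fun _ => ())

/-- The two colours used to individualise a vertex. -/
inductive IndivColour : Type
  | orange
  | grey

open Classical in
/-- The vertex colouring of the vertex-individualised graph `G_v`: the vertex `v` is orange and all
other vertices are grey. -/
noncomputable def individualise {V : Type*} (v : V) (w : V) : IndivColour :=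
  if w = v then IndivColour.orange else IndivColour.grey

/-- Two graphs are `(1,1)`-WL indistinguishable: there is a bijection `π` of their vertices such
that `G_v` and `H_{π v}` are `1`-WL indistinguishable for every vertex `v` of `G`. -/
def OneOneWLIndist {V W : Type*} [Fintype V] [Fintype W]
    (G : SimpleGraph V) (H : SimpleGraph W) : Prop :=
  ∃ π : V ≃ W, ∀ v : V, ColouredWLIndist 1 G (individualise v) H (individualise (π v))

/-! ## Fürer's spectral invariant -/

open Classical in
/-- The adjacency matrix of `G` as an operator on the Euclidean space `ℝ^V`. -/
noncomputable def adjOp {V : Type*} [Fintype V] (G : SimpleGraph V) :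
    Module.End ℝ (EuclideanSpace ℝ V) :=
  Matrix.toEuclideanLin (G.adjMatrix ℝ)

/-- The finite set of the (distinct) eigenvalues of the adjacency matrix. -/
noncomputable def adjEigenvalues {V : Type*} [Fintype V] (G : SimpleGraph V) : Finset ℝ :=
  (Module.End.finite_hasEigenvalue (adjOp G)).toFinset

/-- The multiset of the eigenvalues of the adjacency matrix, with geometric multiplicities. -/
noncomputable def adjSpec {V : Type*} [Fintype V] (G : SimpleGraph V) : Multiset ℝ :=
  ∑ a ∈ adjEigenvalues G,
    Multiset.replicate (Module.finrank ℝ (Module.End.eigenspace (adjOp G) a)) a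

open Classical in
/-- The `(v, w)` entry of the matrix of the orthogonal projection onto the eigenspace of the
adjacency matrix for the eigenvalue `a`. -/
noncomputable def eigenProjEntry {V : Type*} [Fintype V] (G : SimpleGraph V) (a : ℝ)
    (v w : V) : ℝ :=
  (Module.End.eigenspace (adjOp G) a).starProjection (EuclideanSpace.single w 1) v

/-- The tuple `p_{vw}` of the `(v, w)` entries of the projections onto the eigenspaces, in
increasing order of the eigenvalues. -/
noncomputable def furerEntry {V : Type*} [Fintype V] (G : SimpleGraph V) (v w : V) : List ℝ :=
  ((adjEigenvalues G).sort (· ≤ ·)).map fun a => eigenProjEntry G a v w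

/-- Fürer's spectral invariant: the spectrum of the adjacency matrix together with the multiset,
over the vertices `v`, of the pairs of `p_{vv}` and the multiset of all `p_{vw}`. -/
noncomputable def furerInvariant {V : Type*} [Fintype V] (G : SimpleGraph V) :
    Multiset ℝ × Multiset (List ℝ × Multiset (List ℝ)) :=
  (adjSpec G,
    (Finset.univ : Finset V).val.map fun v =>
      (furerEntry G v v, (Finset.univ : Finset V).val.map fun w => furerEntry G v w))

/-! ## Indistinguishability through stable colours -/

/-- The colouring of the `k`-tuples of two graphs together after `d` iterations of `k`-WL. -/
def wlJoint {V W : Type*} [Fintype V] [Fintype W] {C : Type} (k : ℕ)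
    (G : SimpleGraph V) (c : V → C) (H : SimpleGraph W) (c' : W → C) (d : ℕ) :
    (Fin k → V) ⊕ (Fin k → W) → WLColour C k d :=
  Sum.elim (wl G c k d) (wl H c' k d)

/-- One more iteration does not refine the partition of the `k`-tuples of the two graphs. -/
def WLStable {V W : Type*} [Fintype V] [Fintype W] {C : Type} (k : ℕ)
    (G : SimpleGraph V) (c : V → C) (H : SimpleGraph W) (c' : W → C) (d : ℕ) : Prop :=
  ∀ x y, wlJoint k G c H c' d x = wlJoint k G c H c' d y →
    wlJoint k G c H c' (d + 1) x = wlJoint k G c H c' (d + 1) y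

theorem exists_wlStable {V W : Type*} [Fintype V] [Fintype W] {C : Type} (k : ℕ)
    (G : SimpleGraph V) (c : V → C) (H : SimpleGraph W) (c' : W → C) :
    ∃ d, WLStable k G c H c' d := by
  classical
  let S : ℕ → Finset (((Fin k → V) ⊕ (Fin k → W)) × ((Fin k → V) ⊕ (Fin k → W))) := fun d =>
    Finset.univ.filter fun p => wlJoint k G c H c' d p.1 = wlJoint k G c H c' d p.2
  have hsub : ∀ d, S (d + 1) ⊆ S d := by
    intro d p hp
    simp only [S, Finset.mem_filter, Finset.mem_univ, true_and] at hp ⊢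
    rcases p with ⟨x | x, y | y⟩ <;> exact congrArg Prod.fst hp
  let d := Function.argmin (fun d => (S d).card)
  have hd : (S d).card ≤ (S (d + 1)).card := Function.argmin_le (fun d => (S d).card) _
  refine ⟨d, fun x y hxy => ?_⟩
  have he := Finset.eq_of_subset_of_card_le (hsub d) hd
  have hm : (x, y) ∈ S d := by simpa [S] using hxy
  rw [← he] at hm
  simpa [S] using hm

/-- In a stable round, the next colour is a function of the current one, for both graphs. -/
theorem WLStable.exists_factor {V W : Type*} [Fintype V] [Fintype W] {C : Type} {k : ℕ}
    {G : SimpleGraph V} {c : V → C} {H : SimpleGraph W} {c' : W → C} {d : ℕ}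
    (h : WLStable k G c H c' d) :
    (∃ g : WLColour C k d → WLColour C k (d + 1),
      (∀ x, wl G c k (d + 1) x = g (wl G c k d x)) ∧
      (∀ y, wl H c' k (d + 1) y = g (wl H c' k d y))) ∨
      (IsEmpty (Fin k → V) ∧ IsEmpty (Fin k → W)) := by
  classical
  by_cases hne : Nonempty ((Fin k → V) ⊕ (Fin k → W))
  · left
    obtain ⟨x₀⟩ := hne
    have hf : Function.FactorsThrough (wlJoint k G c H c' (d + 1)) (wlJoint k G c H c' d) :=
      fun x y hxy => h x y hxy
    let g := Function.extend (wlJoint k G c H c' d) (wlJoint k G c H c' (d + 1))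
      (fun _ => wlJoint k G c H c' (d + 1) x₀)
    exact ⟨g, fun x => (hf.extend_apply _ (Sum.inl x)).symm,
      fun y => (hf.extend_apply _ (Sum.inr y)).symm⟩
  · right
    rw [not_nonempty_iff, isEmpty_sum] at hne
    exact hne

theorem WLStable.succ {V W : Type*} [Fintype V] [Fintype W] {C : Type} {k : ℕ}
    {G : SimpleGraph V} {c : V → C} {H : SimpleGraph W} {c' : W → C} {d : ℕ}
    (h : WLStable k G c H c' d) : WLStable k G c H c' (d + 1) := by
  rcases h.exists_factor with ⟨g, hg, hg'⟩ | ⟨h₁, h₂⟩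
  · let F : AtomicType C (k + 1) × (Fin k → WLColour C k d) →
        AtomicType C (k + 1) × (Fin k → WLColour C k (d + 1)) := fun p => (p.1, fun i => g (p.2 i))
    have key : ∀ z, wlJoint k G c H c' (d + 2) z =
        (wlJoint k G c H c' (d + 1) z, (wlJoint k G c H c' (d + 1) z).2.map F) := by
      rintro (x | x)
      · change wl G c k (d + 2) x = (wl G c k (d + 1) x, (wl G c k (d + 1) x).2.map F)
        rw [show wl G c k (d + 2) x = (wl G c k (d + 1) x, Multiset.map (fun w =>
          (atp G c (Fin.snoc x w : Fin (k + 1) → V),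
            fun i => wl G c k (d + 1) (Function.update x i w))) Finset.univ.val) from rfl]
        refine congrArg (Prod.mk _) ?_
        simp only [hg]
        rw [← hg x]
        change _ = Multiset.map F (Multiset.map _ _)
        rw [Multiset.map_map]
        rfl
      · change wl H c' k (d + 2) x = (wl H c' k (d + 1) x, (wl H c' k (d + 1) x).2.map F)
        rw [show wl H c' k (d + 2) x = (wl H c' k (d + 1) x, Multiset.map (fun w =>
          (atp H c' (Fin.snoc x w : Fin (k + 1) → W),
            fun i => wl H c' k (d + 1) (Function.update x i w))) Finset.univ.val) from rfl]
        refine congrArg (Prod.mk _) ?_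
        simp only [hg']
        rw [← hg' x]
        change _ = Multiset.map F (Multiset.map _ _)
        rw [Multiset.map_map]
        rfl
    intro x y hxy
    rw [key x, key y, hxy]
  · rintro (x | x)
    · exact h₁.elim x
    · exact h₂.elim x

/-- Indistinguishability is equality of the multisets of stable colours. -/
theorem colouredWLIndist_iff_stable {V W : Type*} [Fintype V] [Fintype W] {C : Type} (k : ℕ)
    (G : SimpleGraph V) (c : V → C) (H : SimpleGraph W) (c' : W → C) :
    ColouredWLIndist k G c H c' ↔
      ∃ d, WLStable k G c H c' d ∧ wlMultiset G c k d = wlMultiset H c' k d := by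
  classical
  constructor
  · intro h
    obtain ⟨d, hd⟩ := exists_wlStable k G c H c'
    exact ⟨d, hd, h d⟩
  · rintro ⟨d, hd, he⟩
    have up : ∀ n, WLStable k G c H c' (d + n) ∧
        wlMultiset G c k (d + n) = wlMultiset H c' k (d + n) := by
      intro n
      induction n with
      | zero => exact ⟨hd, he⟩
      | succ n ih =>
        obtain ⟨hs, hm⟩ := ih
        refine ⟨hs.succ, ?_⟩
        rcases hs.exists_factor with ⟨g, hg, hg'⟩ | ⟨h₁, h₂⟩
        · have e := congrArg (Multiset.map g) hm
          simp only [wlMultiset, Multiset.map_map] at e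
          have e₁ : wl G c k (d + n + 1) = g ∘ wl G c k (d + n) := funext hg
          have e₂ : wl H c' k (d + n + 1) = g ∘ wl H c' k (d + n) := funext hg'
          change wlMultiset G c k (d + n + 1) = wlMultiset H c' k (d + n + 1)
          simp only [wlMultiset]
          rw [e₁, e₂]
          exact e
        · simp [wlMultiset]
    have down : ∀ n, wlMultiset G c k (n + 1) = wlMultiset H c' k (n + 1) →
        wlMultiset G c k n = wlMultiset H c' k n := by
      intro n h
      let p : WLColour C k (n + 1) → WLColour C k n := fun z => Prod.fst z
      have e := congrArg (Multiset.map p) h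
      rw [wlMultiset, wlMultiset, Multiset.map_map, Multiset.map_map] at e
      exact e
    have down' : ∀ m n, wlMultiset G c k (n + m) = wlMultiset H c' k (n + m) →
        wlMultiset G c k n = wlMultiset H c' k n := by
      intro m
      induction m with
      | zero => exact fun n h => h
      | succ m ih => exact fun n h => ih n (down _ h)
    intro n
    apply down' d n
    rw [Nat.add_comm]
    exact (up n).2

/-! ## Spectral projections as polynomials -/

/-! Everything passes through numbers of walks. If a finite set `S` contains the spectrum of the
adjacency matrix `A`, the projection onto the eigenspace of `a ∈ S` is the Lagrange basis polynomial
of `a` evaluated at `A`, so its entries are fixed linear combinations of walk counts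
(`eigenProjEntry_eq`). Taking `S` to contain both spectra, one polynomial serves both graphs; traces
of projections give the multiplicities. Hence `walkProfile` determines Fürer's invariant
(`furerInvariant_eq_of_walkProfile_eq`).

Splitting off the last step of a walk shows that `d` rounds of 1-WL on `G_v` determine the walk
counts from `v` up to length `d`, and that 2-WL does so for pairs of vertices. Both kinds of
indistinguishability thus give equal walk profiles.

For strictness, join 6-vertex blocks (hexagons or pairs of triangles) in two ways. Walk counts see
only that a joined block is 2-regular, not its kind. However, 2-WL sees triangle counts at both ends
of an edge, and these reveal whether blocks of different kinds are joined. -/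

open Classical in
/-- The number of walks of length `k` from `v` to `w`, as an entry of the `k`-th power of the
adjacency matrix. -/
noncomputable def walkCount {V : Type*} [Fintype V] (G : SimpleGraph V) (k : ℕ) (v w : V) : ℝ :=
  (G.adjMatrix ℝ ^ k) v w

open Classical in
theorem walkCount_zero {V : Type*} [Fintype V] (G : SimpleGraph V) (v w : V) :
    walkCount G 0 v w = if v = w then 1 else 0 := by
  simp [walkCount, Matrix.one_apply]

theorem walkCount_succ {V : Type*} [Fintype V] (G : SimpleGraph V) [DecidableRel G.Adj]
    (k : ℕ) (v w : V) :
    walkCount G (k + 1) v w = ∑ u, if G.Adj u w then walkCount G k v u else 0 := by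
  classical
  simp [walkCount, pow_succ, Matrix.mul_apply, SimpleGraph.adjMatrix_apply]

/-- The walk counts from `v` to `w` of all lengths less than `N`. -/
noncomputable def walkVector {V : Type*} [Fintype V] (G : SimpleGraph V) (N : ℕ) (v w : V) :
    Fin N → ℝ :=
  fun k => walkCount G k v w

/-- The analogue of Fürer's invariant for the numbers of walks of length less than `N`. -/
noncomputable def walkProfile {V : Type*} [Fintype V] (G : SimpleGraph V) (N : ℕ) :
    Multiset ((Fin N → ℝ) × Multiset (Fin N → ℝ)) :=
  (Finset.univ : Finset V).val.map fun v =>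
    (walkVector G N v v, (Finset.univ : Finset V).val.map fun w => walkVector G N v w)

/-- The eigenspaces span, and on an eigenvector for `b` the polynomial acts as its value at `b`,
which is 1 if `b = a` and 0 otherwise. Nodes outside the spectrum are harmless: there both sides
vanish. -/
theorem aeval_lagrangeBasis_of_isSymmetric {E : Type*} [NormedAddCommGroup E]
    [InnerProductSpace ℝ E] [FiniteDimensional ℝ E] {T : E →ₗ[ℝ] E} (hT : T.IsSymmetric)
    {S : Finset ℝ} (hS : ∀ b : ℝ, Module.End.HasEigenvalue T b → b ∈ S) {a : ℝ} (ha : a ∈ S) :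
    Polynomial.aeval T (Lagrange.basis S id a) =
      ((Module.End.eigenspace T a).starProjection : E →ₗ[ℝ] E) := by
  ext x
  have hx : x ∈ ⨆ b : ℝ, Module.End.eigenspace T b := by
    rw [Submodule.orthogonal_eq_bot_iff.mp hT.orthogonalComplement_iSup_eigenspaces_eq_bot]
    trivial
  induction hx using Submodule.iSup_induction' with
  | mem b y hy =>
    rcases eq_or_ne y 0 with rfl | hy0
    · simp
    have hv : Module.End.HasEigenvector T b y := ⟨hy, hy0⟩
    have hb : b ∈ S := hS b (Module.End.hasEigenvalue_of_hasEigenvector hv)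
    rw [Module.End.aeval_apply_of_hasEigenvector hv, ContinuousLinearMap.coe_coe]
    rcases eq_or_ne a b with rfl | hab
    · have h1 := Lagrange.eval_basis_self (Function.injective_id.injOn (s := (S : Set ℝ))) ha
      rw [id] at h1
      rw [h1, one_smul, Submodule.starProjection_eq_self_iff.mpr hy]
    · have h0 := Lagrange.eval_basis_of_ne (v := id) hab hb
      rw [id] at h0
      rw [h0, zero_smul, (Submodule.starProjection_apply_eq_zero_iff _).mpr]
      rw [Submodule.mem_orthogonal]
      intro u hu
      exact hT.orthogonalFamily_eigenspaces hab ⟨u, hu⟩ ⟨y, hy⟩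
  | zero => simp
  | add y z _ _ hy hz => rw [map_add, map_add, hy, hz]

theorem Submodule.trace_starProjection_eq_finrank {E : Type*} [NormedAddCommGroup E]
    [InnerProductSpace ℝ E] [FiniteDimensional ℝ E] (K : Submodule ℝ E) :
    LinearMap.trace ℝ E (K.starProjection : E →ₗ[ℝ] E) = Module.finrank ℝ K :=
  LinearMap.IsProj.trace (p := K)
    ⟨fun x => K.starProjection_apply_mem x, fun _ hx => Submodule.starProjection_eq_self_iff.mpr hx⟩

section AdjacencyOperator

variable {V : Type*} [Fintype V] (G : SimpleGraph V)

theorem adjOp_isSymmetric : (adjOp G).IsSymmetric := by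
  classical
  rw [adjOp, Matrix.isSymmetric_toEuclideanLin_iff, Matrix.IsHermitian,
    Matrix.conjTranspose_eq_transpose_of_trivial]
  exact G.transpose_adjMatrix

theorem mem_adjEigenvalues {a : ℝ} :
    a ∈ adjEigenvalues G ↔ Module.End.HasEigenvalue (adjOp G) a := by
  simp [adjEigenvalues]

open Classical in
theorem adjOp_pow_single (k : ℕ) (v w : V) :
    (adjOp G ^ k) (EuclideanSpace.single w 1) v = walkCount G k v w := by
  have h : adjOp G ^ k = Matrix.toEuclideanLin (G.adjMatrix ℝ ^ k) := by
    induction k with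
    | zero => ext; simp
    | succ k ih =>
      rw [pow_succ, ih]
      ext
      simp [adjOp, Matrix.toLpLin_apply, pow_succ]
  rw [h, Matrix.toLpLin_apply]
  simp [walkCount]

open Classical in
theorem aeval_adjOp_single {p : Polynomial ℝ} {N : ℕ} (hp : p.natDegree < N) (v w : V) :
    Polynomial.aeval (adjOp G) p (EuclideanSpace.single w 1) v =
      ∑ k : Fin N, p.coeff k * walkVector G N v w k := by
  rw [Polynomial.aeval_eq_sum_range' hp, Finset.sum_range]
  simp [walkVector, adjOp_pow_single]

/-- The value that the `a`-th Lagrange basis polynomial at the nodes `S` takes on a vector of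
walk counts. -/
noncomputable def lagrangeValue (S : Finset ℝ) (a : ℝ) (x : Fin S.card → ℝ) : ℝ :=
  ∑ k : Fin S.card, (Lagrange.basis S id a).coeff k * x k

/-- The function on the right depends on `S` and `a` but not on `G`, which makes entries of
different graphs comparable. -/
theorem eigenProjEntry_eq {S : Finset ℝ} (hS : adjEigenvalues G ⊆ S) {a : ℝ} (ha : a ∈ S)
    (v w : V) :
    eigenProjEntry G a v w = lagrangeValue S a (walkVector G S.card v w) := by
  classical
  have hdeg : (Lagrange.basis S id a).natDegree < S.card := by
    rw [Lagrange.natDegree_basis Function.injective_id.injOn ha]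
    exact Nat.sub_lt (Finset.card_pos.mpr ⟨a, ha⟩) one_pos
  rw [lagrangeValue, ← aeval_adjOp_single G hdeg,
    aeval_lagrangeBasis_of_isSymmetric (adjOp_isSymmetric G)
      (fun b hb => hS ((mem_adjEigenvalues G).mpr hb)) ha, eigenProjEntry]
  simp only [ContinuousLinearMap.coe_coe]

theorem finrank_eigenspace_adjOp (a : ℝ) :
    (Module.finrank ℝ (Module.End.eigenspace (adjOp G) a) : ℝ) =
      ∑ v, eigenProjEntry G a v v := by
  classical
  rw [← Submodule.trace_starProjection_eq_finrank,
    LinearMap.trace_eq_matrix_trace ℝ (EuclideanSpace.basisFun V ℝ).toBasis, Matrix.trace]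
  refine Finset.sum_congr rfl fun v _ => ?_
  simp only [Matrix.diag_apply, LinearMap.toMatrix_apply, eigenProjEntry]
  simp

end AdjacencyOperator

theorem furerInvariant_eq_of_walkProfile_eq {V W : Type*} [Fintype V] [Fintype W]
    {G : SimpleGraph V} {H : SimpleGraph W} (h : ∀ N, walkProfile G N = walkProfile H N) :
    furerInvariant G = furerInvariant H := by
  classical
  let S := adjEigenvalues G ∪ adjEigenvalues H
  have hG : adjEigenvalues G ⊆ S := Finset.subset_union_left
  have hH : adjEigenvalues H ⊆ S := Finset.subset_union_right
  have hrank : ∀ a ∈ S, Module.finrank ℝ (Module.End.eigenspace (adjOp G) a) =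
      Module.finrank ℝ (Module.End.eigenspace (adjOp H) a) := by
    intro a ha
    -- Summing over the diagonal walk vectors yields the traces of the two projections.
    have e := congrArg (fun m => (m.map fun p => lagrangeValue S a p.1).sum) (h S.card)
    simp only [walkProfile, Multiset.map_map, Function.comp_def, ← eigenProjEntry_eq G hG ha,
      ← eigenProjEntry_eq H hH ha] at e
    have e' : ∑ v, eigenProjEntry G a v v = ∑ v, eigenProjEntry H a v v := e
    rw [← finrank_eigenspace_adjOp, ← finrank_eigenspace_adjOp] at e'
    exact_mod_cast e'
  have heig : adjEigenvalues G = adjEigenvalues H := by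
    ext a
    -- For `a` in `S`, being an eigenvalue means that the eigenspace has nonzero dimension, and the
    -- dimensions agree.
    by_cases ha : a ∈ S
    · rw [mem_adjEigenvalues, mem_adjEigenvalues]
      simp only [Module.End.HasEigenvalue, Module.End.HasUnifEigenvalue, Ne,
        ← Submodule.finrank_eq_zero (R := ℝ)]
      exact not_congr (by rw [← Module.End.eigenspace, hrank a ha])
    · exact ⟨fun h' => absurd (hG h') ha, fun h' => absurd (hH h') ha⟩
  let φ : (Fin S.card → ℝ) → List ℝ := fun x =>
    ((adjEigenvalues G).sort (· ≤ ·)).map fun a => lagrangeValue S a x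
  have hφG : ∀ v w, furerEntry G v w = φ (walkVector G S.card v w) := fun v w =>
    List.map_congr_left fun a ha => eigenProjEntry_eq G hG (hG ((Finset.mem_sort _).mp ha)) v w
  have hφH : ∀ v w, furerEntry H v w = φ (walkVector H S.card v w) := by
    intro v w
    simp only [furerEntry, φ, heig]
    exact List.map_congr_left fun a ha =>
      eigenProjEntry_eq H hH (hH ((Finset.mem_sort _).mp ha)) v w
  refine Prod.ext ?_ ?_
  · simp only [furerInvariant, adjSpec, heig]
    exact Finset.sum_congr rfl fun a ha => by rw [hrank a (hH ha)]
  · have e := congrArg (Multiset.map fun p => (φ p.1, p.2.map φ)) (h S.card)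
    simpa only [walkProfile, Multiset.map_map, Function.comp_def, ← hφG, ← hφH,
      furerInvariant] using e

/-! ## Colours determine walk counts -/

theorem Multiset.map_eq_map_of_imp {α β γ δ : Type*} {s : Multiset α} {t : Multiset β}
    {f : α → γ} {g : β → γ} (h : s.map f = t.map g) {F : α → δ} {F' : β → δ}
    (himp : ∀ a b, f a = g b → F a = F' b) : s.map F = t.map F' := by
  rw [← Multiset.rel_eq, Multiset.rel_map] at h ⊢
  exact h.mono fun a _ b _ hab => himp a b hab

theorem Multiset.Rel.filter {α β : Type*} {r : α → β → Prop} {s : Multiset α} {t : Multiset β}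
    (h : Multiset.Rel r s t) {p : α → Prop} {q : β → Prop} [DecidablePred p] [DecidablePred q]
    (hpq : ∀ a b, r a b → (p a ↔ q b)) : Multiset.Rel r (s.filter p) (t.filter q) := by
  induction h with
  | zero => simp
  | @cons a b _ _ hab _ ih =>
    by_cases hp : p a
    · rw [Multiset.filter_cons_of_pos _ hp, Multiset.filter_cons_of_pos _ ((hpq a b hab).mp hp)]
      exact ih.cons hab
    · rw [Multiset.filter_cons_of_neg _ hp,
        Multiset.filter_cons_of_neg _ (fun hq => hp ((hpq a b hab).mpr hq))]
      exact ih

theorem Finset.sum_eq_sum_of_map_eq_map {α β γ δ : Type*} [Fintype α] [Fintype β]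
    [AddCommMonoid δ] {f : α → γ} {g : β → γ}
    (h : (Finset.univ : Finset α).val.map f = (Finset.univ : Finset β).val.map g)
    {F : α → δ} {F' : β → δ} (himp : ∀ a b, f a = g b → F a = F' b) : ∑ a, F a = ∑ b, F' b :=
  congrArg Multiset.sum (Multiset.map_eq_map_of_imp h himp)

section AtomicTypes

variable {V W : Type*} {C : Type} {G : SimpleGraph V} {c : V → C} {H : SimpleGraph W} {c' : W → C}

theorem eq_iff_of_atp_eq {ℓ : ℕ} {x : Fin ℓ → V} {y : Fin ℓ → W} (h : atp G c x = atp H c' y)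
    (i j : Fin ℓ) : x i = x j ↔ y i = y j :=
  iff_of_eq (congrFun (congrFun (congrArg AtomicType.eq h) i) j)

theorem adj_iff_of_atp_eq {ℓ : ℕ} {x : Fin ℓ → V} {y : Fin ℓ → W} (h : atp G c x = atp H c' y)
    (i j : Fin ℓ) : G.Adj (x i) (x j) ↔ H.Adj (y i) (y j) :=
  iff_of_eq (congrFun (congrFun (congrArg AtomicType.adj h) i) j)

theorem colour_eq_of_atp_eq {ℓ : ℕ} {x : Fin ℓ → V} {y : Fin ℓ → W} (h : atp G c x = atp H c' y)
    (i : Fin ℓ) : c (x i) = c' (y i) :=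
  congrFun (congrArg AtomicType.colour h) i

theorem atp_snoc_one_adj_iff {a u : V} {b z : W}
    (h : atp G c (Fin.snoc ![a] u : Fin 2 → V) = atp H c' (Fin.snoc ![b] z : Fin 2 → W)) :
    G.Adj u a ↔ H.Adj z b :=
  adj_iff_of_atp_eq h 1 0

theorem atp_snoc_two_adj_iff {a a' u : V} {b b' z : W}
    (h : atp G c (Fin.snoc ![a, a'] u : Fin 3 → V) = atp H c' (Fin.snoc ![b, b'] z : Fin 3 → W)) :
    (G.Adj u a ↔ H.Adj z b) ∧ (G.Adj u a' ↔ H.Adj z b') :=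
  ⟨adj_iff_of_atp_eq h 2 0, adj_iff_of_atp_eq h 2 1⟩

theorem update_pair_zero (a b u : V) : Function.update ![a, b] 0 u = ![u, b] := by
  ext i
  fin_cases i <;> rfl

theorem update_pair_one (a b u : V) : Function.update ![a, b] 1 u = ![a, u] := by
  ext i
  fin_cases i <;> rfl

theorem update_single_zero (a u : V) : Function.update ![a] 0 u = ![u] := by
  ext i
  fin_cases i
  rfl

end AtomicTypes

section Colours

variable {V W : Type*} [Fintype V] [Fintype W] {C : Type} {G : SimpleGraph V} {c : V → C}
  {H : SimpleGraph W} {c' : W → C} {k : ℕ}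

theorem wl_eq_of_succ {d : ℕ} {x : Fin k → V} {y : Fin k → W}
    (h : wl G c k (d + 1) x = wl H c' k (d + 1) y) : wl G c k d x = wl H c' k d y :=
  congrArg Prod.fst h

theorem atp_eq_of_wl_eq {d : ℕ} {x : Fin k → V} {y : Fin k → W}
    (h : wl G c k d x = wl H c' k d y) : atp G c x = atp H c' y := by
  induction d with
  | zero => exact h
  | succ d ih => exact ih (wl_eq_of_succ h)

theorem wl_succ_multiset {d : ℕ} {x : Fin k → V} {y : Fin k → W}
    (h : wl G c k (d + 1) x = wl H c' k (d + 1) y) :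
    ((Finset.univ : Finset V).val.map fun w =>
        (atp G c (Fin.snoc x w : Fin (k + 1) → V), fun i => wl G c k d (Function.update x i w))) =
      (Finset.univ : Finset W).val.map fun w =>
        (atp H c' (Fin.snoc y w : Fin (k + 1) → W),
          fun i => wl H c' k d (Function.update y i w)) :=
  congrArg Prod.snd h

/-- In equal colours of pairs, corresponding third vertices have equal colours one round before. -/
theorem wl_two_sum_eq {δ : Type*} [AddCommMonoid δ] {d : ℕ} {a a' : V} {b b' : W}
    (h : wl G c 2 (d + 1) ![a, a'] = wl H c' 2 (d + 1) ![b, b']) {F : V → δ} {F' : W → δ}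
    (himp : ∀ u z, (G.Adj u a ↔ H.Adj z b) → (G.Adj u a' ↔ H.Adj z b') →
      wl G c 2 d ![u, a'] = wl H c' 2 d ![z, b'] → wl G c 2 d ![a, u] = wl H c' 2 d ![b, z] →
      F u = F' z) :
    ∑ u, F u = ∑ z, F' z := by
  refine Finset.sum_eq_sum_of_map_eq_map (wl_succ_multiset h) fun u z huz => ?_
  have h1 := atp_snoc_two_adj_iff (congrArg Prod.fst huz)
  have h2 := congrFun (congrArg Prod.snd huz)
  refine himp u z h1.1 h1.2 ?_ ?_
  · simpa only [update_pair_zero] using h2 0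
  · simpa only [update_pair_one] using h2 1

/-- A walk from `a` to `a'` ends with an edge from some `u` to `a'`; one round exposes both this
adjacency and the previous colour of the pair `(a, u)`. Each unit of length costs one round. -/
theorem walkCount_eq_of_wl_two_eq {d : ℕ} {a a' : V} {b b' : W}
    (h : wl G c 2 d ![a, a'] = wl H c' 2 d ![b, b']) {k : ℕ} (hk : k ≤ d) :
    walkCount G k a a' = walkCount H k b b' := by
  classical
  induction k generalizing d a' b' with
  | zero =>
    have := eq_iff_of_atp_eq (atp_eq_of_wl_eq h) 0 1
    simp only [Matrix.cons_val_zero, Matrix.cons_val_one] at this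
    simp only [walkCount_zero, this]
  | succ k ih =>
    obtain ⟨d, rfl⟩ : ∃ e, d = e + 1 := ⟨d - 1, by omega⟩
    simp only [walkCount_succ]
    refine wl_two_sum_eq h fun u z _ h1 _ h2 => ?_
    rw [ih h2 (by omega)]
    simp only [h1]

/-- The same induction on the last step, with the orange vertex playing the role of the fixed start.
-/
theorem walkCount_eq_of_wl_one_eq {v : V} {v' : W} {d : ℕ} {a : V} {b : W}
    (h : wl G (individualise v) 1 d ![a] = wl H (individualise v') 1 d ![b]) {k : ℕ}
    (hk : k ≤ d) : walkCount G k v a = walkCount H k v' b := by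
  classical
  induction k generalizing d a b with
  | zero =>
    have := colour_eq_of_atp_eq (atp_eq_of_wl_eq h) 0
    simp only [Matrix.cons_val_zero, individualise] at this
    simp only [walkCount_zero, eq_comm (a := v), eq_comm (a := v')]
    split_ifs at this ⊢ <;> simp_all
  | succ k ih =>
    obtain ⟨d, rfl⟩ : ∃ e, d = e + 1 := ⟨d - 1, by omega⟩
    simp only [walkCount_succ]
    refine Finset.sum_eq_sum_of_map_eq_map (wl_succ_multiset h) fun u z huz => ?_
    have h1 := atp_snoc_one_adj_iff (congrArg Prod.fst huz)
    have h2 := congrFun (congrArg Prod.snd huz) 0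
    simp only [update_single_zero] at h2
    rw [ih h2 (by omega)]
    simp only [h1]

theorem eq_iff_of_wl_individualise_eq {v : V} {v' : W} {d : ℕ} {a : V} {b : W}
    (h : wl G (individualise v) 1 d ![a] = wl H (individualise v') 1 d ![b]) :
    v = a ↔ v' = b := by
  classical
  have := walkCount_eq_of_wl_one_eq h (Nat.zero_le d)
  rw [walkCount_zero, walkCount_zero] at this
  split_ifs at this <;> simp_all

end Colours

/-! ### Indistinguishable graphs have equal walk profiles -/

section Indistinguishable

variable {V W : Type*} [Fintype V] [Fintype W] {G : SimpleGraph V} {H : SimpleGraph W}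

theorem walkVector_eq {N : ℕ} {v a : V} {w b : W}
    (h : ∀ k < N, walkCount G k v a = walkCount H k w b) : walkVector G N v a = walkVector H N w b :=
  funext fun k => h k k.2

theorem wlMultiset_one_eq {U : Type*} [Fintype U] {C : Type} (K : SimpleGraph U) (c : U → C)
    (d : ℕ) :
    wlMultiset K c 1 d = (Finset.univ : Finset U).val.map fun a => wl K c 1 d ![a] := by
  rw [wlMultiset, ← Finset.map_univ_equiv (Equiv.funUnique (Fin 1) U).symm, Finset.map_val,
    Multiset.map_map]
  refine Multiset.map_congr rfl fun a _ => congrArg (wl K c 1 d) ?_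
  ext i
  simp [Subsingleton.elim i 0]

theorem map_wl_one_eq {C : Type} {c : V → C} {c' : W → C} (h : ColouredWLIndist 1 G c H c')
    (d : ℕ) :
    ((Finset.univ : Finset V).val.map fun a => wl G c 1 d ![a]) =
      (Finset.univ : Finset W).val.map fun b => wl H c' 1 d ![b] := by
  exact (wlMultiset_one_eq G c d).symm.trans ((h d).trans (wlMultiset_one_eq H c' d))

theorem OneOneWLIndist.walkProfile_eq (h : OneOneWLIndist G H) (N : ℕ) :
    walkProfile G N = walkProfile H N := by
  obtain ⟨π, hπ⟩ := h
  rw [walkProfile, walkProfile, ← Finset.map_univ_equiv π, Finset.map_val, Multiset.map_map]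
  refine Multiset.map_congr rfl fun v _ => ?_
  have hm := map_wl_one_eq (hπ v) N
  refine Prod.ext ?_ ?_
  · have hv : wl G (individualise v) 1 N ![v] ∈
        (Finset.univ : Finset W).val.map fun b => wl H (individualise (π v)) 1 N ![b] :=
      hm ▸ Multiset.mem_map_of_mem _ (Finset.mem_univ v)
    obtain ⟨b, -, hb⟩ := Multiset.mem_map.mp hv
    -- Only the orange vertex can share the colour of an orange vertex, so `b` is `π v`.
    obtain rfl := (eq_iff_of_wl_individualise_eq hb.symm).mp rfl
    exact walkVector_eq fun k hk => walkCount_eq_of_wl_one_eq hb.symm hk.le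
  · have := Multiset.map_eq_map_of_imp hm (F := walkVector G N v) (F' := walkVector H N (π v))
      fun a b hab => walkVector_eq fun k hk => walkCount_eq_of_wl_one_eq hab hk.le
    simpa using this

/-- The extra round turns the colour of `(a, a)` into the multiset of `N`-round colours of all `(a,
u)`. -/
theorem diagonal_profile_eq {C : Type} {c : V → C} {c' : W → C} {N : ℕ} {a : V} {b : W}
    (h : wl G c 2 (N + 1) ![a, a] = wl H c' 2 (N + 1) ![b, b]) :
    (walkVector G N a a, (Finset.univ : Finset V).val.map fun w => walkVector G N a w) =
      (walkVector H N b b, (Finset.univ : Finset W).val.map fun w => walkVector H N b w) := by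
  refine Prod.ext (walkVector_eq fun k hk => walkCount_eq_of_wl_two_eq h (by omega)) ?_
  refine Multiset.map_eq_map_of_imp (wl_succ_multiset h) fun u z huz => ?_
  have h2 : wl G c 2 N ![a, u] = wl H c' 2 N ![b, z] := by
    simpa only [update_pair_one] using congrFun (congrArg Prod.snd huz) 1
  exact walkVector_eq fun k hk => walkCount_eq_of_wl_two_eq h2 hk.le

theorem filter_diagonal_eq (V : Type*) [Fintype V] 
    [DecidablePred fun x : Fin 2 → V => x 0 = x 1] :
    (Finset.univ : Finset (Fin 2 → V)).filter (fun x => x 0 = x 1) =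
      Finset.univ.map ⟨fun a => ![a, a], fun a b h => by simpa using congrFun h 0⟩ := by
  ext x
  simp only [Finset.mem_filter, Finset.mem_univ, true_and, Finset.mem_map]
  constructor
  · intro h
    refine ⟨x 0, ?_⟩
    ext i
    fin_cases i
    · rfl
    · exact h
  · rintro ⟨a, rfl⟩
    rfl

theorem WLIndist.walkProfile_eq (h : WLIndist 2 G H) (N : ℕ) :
    walkProfile G N = walkProfile H N := by
  classical
  have hm := h (N + 1)
  rw [wlMultiset, wlMultiset, ← Multiset.rel_eq, Multiset.rel_map] at hm
  -- Atomic types recognise diagonal pairs, so the matching of equally coloured pairs restricts to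
  -- the diagonals, that is, to the vertices.
  have hf : Multiset.Rel (fun x y => wl G (fun _ => ()) 2 (N + 1) x = wl H (fun _ => ()) 2 (N + 1) y)
      ((Finset.univ : Finset (Fin 2 → V)).val.filter fun x => x 0 = x 1)
      ((Finset.univ : Finset (Fin 2 → W)).val.filter fun x => x 0 = x 1) :=
    hm.filter fun x y hxy => eq_iff_of_atp_eq (atp_eq_of_wl_eq hxy) 0 1
  rw [← Finset.filter_val, ← Finset.filter_val, filter_diagonal_eq, filter_diagonal_eq,
    Finset.map_val, Finset.map_val, Multiset.rel_map] at hf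
  rw [walkProfile, walkProfile, ← Multiset.rel_eq, Multiset.rel_map]
  exact hf.mono fun a _ b _ hab => diagonal_profile_eq hab

end Indistinguishable

/-! ## Separating Fürer's invariant from `2`-WL -/

section Quotient

variable {V I : Type*} [Fintype V] [Fintype I] [DecidableEq I]

/-- The number of walks of length `k` from a class of vertices to the class `o`, in terms of the
quotient matrix `M` of an equitable partition. -/
def quotientWalk (M : I → I → ℕ) (o : I → Bool) : ℕ → I → ℝ
  | 0, i => if o i then 1 else 0
  | k + 1, i => ∑ j, M i j * quotientWalk M o k j

/-- Here `f v` is the partition rooted at `v`. Grouping the penultimate vertices by class gives the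
recursion of `quotientWalk`; the matrix `M` is shared by all roots. -/
theorem walkCount_eq_quotientWalk {G : SimpleGraph V} [DecidableRel G.Adj] {f : V → V → I}
    {M : I → I → ℕ} {o : I → Bool} (ho : ∀ v w, v = w ↔ o (f v w) = true)
    (hM : ∀ v w i, (Finset.univ.filter fun u => G.Adj u w ∧ f v u = i).card = M (f v w) i)
    (k : ℕ) (v w : V) : walkCount G k v w = quotientWalk M o k (f v w) := by
  classical
  induction k generalizing w with
  | zero => simp only [walkCount_zero, quotientWalk, ho]
  | succ k ih =>
    rw [walkCount_succ, quotientWalk, ← Finset.sum_filter,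
      ← Finset.sum_fiberwise (g := fun u => f v u)]
    refine Finset.sum_congr rfl fun j _ => ?_
    rw [Finset.filter_filter, ← hM v w j, ← nsmul_eq_mul, ← Finset.sum_const]
    refine Finset.sum_congr (by congr!) fun u hu => ?_
    rw [ih u, (Finset.mem_filter.mp hu).2.2]

theorem walkProfile_eq_of_quotient {G H : SimpleGraph V} [DecidableRel G.Adj] [DecidableRel H.Adj]
    {f g : V → V → I} {M : I → I → ℕ} {o : I → Bool}
    (hoG : ∀ v w, v = w ↔ o (f v w) = true) (hoH : ∀ v w, v = w ↔ o (g v w) = true)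
    (hMG : ∀ v w i, (Finset.univ.filter fun u => G.Adj u w ∧ f v u = i).card = M (f v w) i)
    (hMH : ∀ v w i, (Finset.univ.filter fun u => H.Adj u w ∧ g v u = i).card = M (g v w) i)
    (hdiag : ∀ v, f v v = g v v)
    (hfg : ∀ v, (Finset.univ : Finset V).val.map (f v) = (Finset.univ : Finset V).val.map (g v))
    (N : ℕ) : walkProfile G N = walkProfile H N := by
  have hG : ∀ v w, walkVector G N v w = fun k : Fin N => quotientWalk M o k (f v w) :=
    fun v w => funext fun k => walkCount_eq_quotientWalk hoG hMG k v w
  have hH : ∀ v w, walkVector H N v w = fun k : Fin N => quotientWalk M o k (g v w) :=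
    fun v w => funext fun k => walkCount_eq_quotientWalk hoH hMH k v w
  refine Multiset.map_congr rfl fun v _ => Prod.ext ?_ ?_
  · simp only [hG, hH, hdiag]
  · simp only [hG, hH]
    exact Multiset.map_eq_map_of_imp (hfg v) fun a b hab => by rw [hab]

end Quotient

/-! ### Triangle counts seen by `2`-WL -/

section Triangles

variable {V W : Type*} [Fintype V] [Fintype W]

/-- The number of common neighbours of two vertices. -/
def commonCount (G : SimpleGraph V) [DecidableRel G.Adj] (a b : V) : ℕ :=
  ∑ u, if G.Adj u a ∧ G.Adj u b then 1 else 0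

theorem commonCount_comm (G : SimpleGraph V) [DecidableRel G.Adj] (a b : V) :
    commonCount G a b = commonCount G b a := by
  simp only [commonCount, and_comm]

/-- Twice the number of triangles through a vertex. -/
def triangleCount (G : SimpleGraph V) [DecidableRel G.Adj] (a : V) : ℕ :=
  ∑ u, if G.Adj u a then commonCount G u a else 0

variable {C : Type} {G : SimpleGraph V} [DecidableRel G.Adj] {c : V → C} {H : SimpleGraph W}
  [DecidableRel H.Adj] {c' : W → C} {a a' : V} {b b' : W}

theorem commonCount_eq_of_wl_two_eq {d : ℕ}
    (h : wl G c 2 (d + 1) ![a, a'] = wl H c' 2 (d + 1) ![b, b']) :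
    commonCount G a a' = commonCount H b b' :=
  wl_two_sum_eq h fun u z h1 h2 _ _ => by simp only [h1, h2]

/-- One round reaches the pairs formed with a neighbour `u`, the other counts the common neighbours
of such a pair. -/
theorem triangleCount_eq_of_wl_two_eq {d : ℕ}
    (h : wl G c 2 (d + 2) ![a, a'] = wl H c' 2 (d + 2) ![b, b']) :
    triangleCount G a = triangleCount H b ∧ triangleCount G a' = triangleCount H b' := by
  constructor
  · refine wl_two_sum_eq h fun u z h1 _ _ h2 => ?_
    rw [commonCount_comm, commonCount_eq_of_wl_two_eq h2, commonCount_comm]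
    simp only [h1]
  · refine wl_two_sum_eq h fun u z _ h1 h2 _ => ?_
    rw [commonCount_eq_of_wl_two_eq h2]
    simp only [h1]

/-- `2`-WL sees the numbers of triangles through the two ends of an edge. -/
theorem WLIndist.exists_adj_triangleCount (h : WLIndist 2 G H) (hb : H.Adj b b') :
    ∃ a a' : V, G.Adj a a' ∧ triangleCount G a = triangleCount H b ∧
      triangleCount G a' = triangleCount H b' := by
  have hm : wl H (fun _ => ()) 2 2 ![b, b'] ∈ wlMultiset G (fun _ => ()) 2 2 :=
    h 2 ▸ Multiset.mem_map_of_mem _ (Finset.mem_univ _)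
  obtain ⟨x, -, hx⟩ := Multiset.mem_map.mp hm
  have e : ![x 0, x 1] = x := by
    ext i
    fin_cases i <;> rfl
  rw [← e] at hx
  exact ⟨x 0, x 1, (adj_iff_of_atp_eq (atp_eq_of_wl_eq hx) 0 1).mpr hb,
    triangleCount_eq_of_wl_two_eq hx⟩

end Triangles

/-! ### Two graphs on 24 vertices -/

section Example

/-- Adjacency in a `6`-cycle. -/
def hexagonAdj (p q : ℕ) : Bool :=
  (p + 1) % 6 == q || (q + 1) % 6 == p

/-- Adjacency in the disjoint union of two triangles. -/
def twoTrianglesAdj (p q : ℕ) : Bool :=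
  p / 3 == q / 3 && p != q

/-- Four blocks of six vertices, of which the first two induce hexagons and the last two induce
pairs of triangles. Two different blocks are completely joined if `j` holds for them. -/
def blockAdj (j : ℕ → ℕ → Bool) (v w : Fin 24) : Bool :=
  if v.val / 6 = w.val / 6 then
    if v.val < 12 then hexagonAdj (v.val % 6) (w.val % 6)
    else twoTrianglesAdj (v.val % 6) (w.val % 6)
  else j (v.val / 6) (w.val / 6)

/-- Blocks of the same kind are joined. -/
def joinLike (i j : ℕ) : Bool :=
  i / 2 == j / 2

/-- Every hexagon block is joined with a block of triangles. -/
def joinUnlike (i j : ℕ) : Bool :=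
  i % 2 == j % 2

/-- The join of two hexagons together with the join of two pairs of triangles. -/
def likeGraph : SimpleGraph (Fin 24) where
  Adj v w := blockAdj joinLike v w = true
  symm := ⟨by decide +kernel⟩
  loopless := ⟨by decide +kernel⟩

/-- Two copies of the join of a hexagon with a pair of triangles. -/
def unlikeGraph : SimpleGraph (Fin 24) where
  Adj v w := blockAdj joinUnlike v w = true
  symm := ⟨by decide +kernel⟩
  loopless := ⟨by decide +kernel⟩

instance : DecidableRel likeGraph.Adj := fun v w =>
  inferInstanceAs (Decidable (blockAdj joinLike v w = true))

instance : DecidableRel unlikeGraph.Adj := fun v w =>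
  inferInstanceAs (Decidable (blockAdj joinUnlike v w = true))

/-- The class of `w` in an equitable partition after individualising `v`. -/
def blockClass (j : ℕ → ℕ → Bool) (v w : Fin 24) : Fin 10 :=
  if v.val / 6 = w.val / 6 then
    -- Distance in the hexagon; adding 6 avoids truncated subtraction and does not change the
    -- residue.
    if v.val < 12 then ![0, 1, 2, 3, 2, 1] (Fin.ofNat 6 (v.val + 6 - w.val))
    else if v = w then 4 else if v.val / 3 = w.val / 3 then 5 else 6
  -- The joined block is a single class since it is 2-regular whatever its kind. Class 9 is the
  -- 8-regular other component.
  else if j (v.val / 6) (w.val / 6) then if v.val < 12 then 7 else 8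
  else 9

/-- The classes that consist of the individualised vertex. -/
def isRootClass (i : Fin 10) : Bool :=
  i == 0 || i == 4

/-- The common quotient matrix of the partitions into the classes `blockClass`. -/
def blockQuotient : Fin 10 → Fin 10 → ℕ :=
  ![![0, 2, 0, 0, 0, 0, 0, 6, 0, 0],
    ![1, 0, 1, 0, 0, 0, 0, 6, 0, 0],
    ![0, 1, 0, 1, 0, 0, 0, 6, 0, 0],
    ![0, 0, 2, 0, 0, 0, 0, 6, 0, 0],
    ![0, 0, 0, 0, 0, 2, 0, 0, 6, 0],
    ![0, 0, 0, 0, 1, 1, 0, 0, 6, 0],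
    ![0, 0, 0, 0, 0, 0, 2, 0, 6, 0],
    ![1, 2, 2, 1, 0, 0, 0, 2, 0, 0],
    ![0, 0, 0, 0, 1, 2, 3, 0, 2, 0],
    ![0, 0, 0, 0, 0, 0, 0, 0, 0, 8]]

theorem walkProfile_likeGraph (N : ℕ) : walkProfile likeGraph N = walkProfile unlikeGraph N :=
  walkProfile_eq_of_quotient (f := blockClass joinLike) (g := blockClass joinUnlike)
    (M := blockQuotient) (o := isRootClass) (by decide +kernel) (by decide +kernel)
    (by decide +kernel) (by decide +kernel) (by decide +kernel) (by decide +kernel) N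

/-- A neighbourhood contains 6 edges inside the joined block, 12 edges between this block and the
two neighbours in the block of `v`, and in a triangle block one more edge between those two: 18 or
19 triangles, counted twice. -/
theorem triangleCount_likeGraph (v : Fin 24) :
    triangleCount likeGraph v = if v.val < 12 then 36 else 38 := by
  revert v
  decide +kernel

theorem triangleCount_unlikeGraph (v : Fin 24) :
    triangleCount unlikeGraph v = if v.val < 12 then 36 else 38 := by
  revert v
  decide +kernel

theorem likeGraph_adj_lt_iff : ∀ v w, likeGraph.Adj v w → (v.val < 12 ↔ w.val < 12) := by
  decide +kernel

theorem not_wlIndist_likeGraph : ¬ WLIndist 2 likeGraph unlikeGraph := by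
  intro h
  -- An edge between a hexagon and a triangle block, with counts 36 and 38 at its ends; no edge of
  -- `likeGraph` joins blocks of different kinds.
  have hadj : unlikeGraph.Adj 0 12 := by decide +kernel
  obtain ⟨a, a', haa, h1, h2⟩ := h.exists_adj_triangleCount hadj
  have hlt := likeGraph_adj_lt_iff a a' haa
  rw [triangleCount_likeGraph, triangleCount_unlikeGraph] at h1 h2
  by_cases ha : a.val < 12
  · simp [hlt.mp ha] at h2
  · simp [ha] at h1

end Example

theorem mainTheorem2 :
    (∀ (V W : Type*) [Fintype V] [Fintype W] (G : SimpleGraph V) (H : SimpleGraph W),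
      OneOneWLIndist G H → furerInvariant G = furerInvariant H) ∧
    (∀ (V W : Type*) [Fintype V] [Fintype W] (G : SimpleGraph V) (H : SimpleGraph W),
      WLIndist 2 G H → furerInvariant G = furerInvariant H) ∧
    (∃ (n : ℕ) (G H : SimpleGraph (Fin n)),
      furerInvariant G = furerInvariant H ∧ ¬ WLIndist 2 G H) :=
  ⟨fun _ _ _ _ _ _ h => furerInvariant_eq_of_walkProfile_eq h.walkProfile_eq,
    fun _ _ _ _ _ _ h => furerInvariant_eq_of_walkProfile_eq h.walkProfile_eq,
    24, likeGraph, unlikeGraph, furerInvariant_eq_of_walkProfile_eq walkProfile_likeGraph,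
    not_wlIndist_likeGraph⟩
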